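/- Let $n\ge 1$ be an integer, let $D\subseteq\mathbb C$ be an open set containing $[0,1]$, and let $f$ be analytic in $D$. The Hadamard finite-part integral is defined by $$\mathrm{f.p.}\!\int_0^1 x^{-n}f(x)\,dx=\lim_{\epsilon\downarrow0}\Big\{\int_\epsilon^1 x^{-n}f(x)\,dx-\sum_{k=0}^{n-2}\frac{\epsilon^{k+1-n}}{k!\,(n-1-k)}f^{(k)}(0)+\frac{\log\epsilon}{(n-1)!}f^{(n-1)}(0)\Big\},$$ where the sum is zero if $n=1$. Let $d>0$, $u_p>0$, $D_d=\{w\in\mathbb C:|\operatorname{Im}w|<d\}$, and let $\varphi$ be analytic in $D_d$ with $\varphi(u+u_p)=\varphi(u)$ for all real $u$. Suppose that * the closed curve $C: z=\varphi(u)$, $0\le u\le u_p$, lies in $D$ and encircles $[0,1]$ once in the positive sense in $D$, that is, $C$ has winding number $1$ about every point of $[0,1]$ and winding number $0$ about every point of $\mathbb C\setminus D$; * $\varphi(D_d)\subseteq\mathbb C\setminus[0,1]$; * $f$ is also analytic at every point of $\varphi(D_d)$ (as one function on $D\cup\varphi(D_d)$). For $N\ge1$ put $h=u_p/N$ and $$I_N^{(n)}[f]=\frac{h}{2\pi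 i}\sum_{k=0}^{N-1}\varphi(kh)^{-n}f(\varphi(kh))\log\!\Big(\frac{\varphi(kh)}{\varphi(kh)-1}\Big)\varphi'(kh)-\sum_{k=0}^{n-2}\frac{f^{(k)}(0)}{k!\,(n-1-k)},$$ with the principal branch of $\log$, the last sum being zero if $n=1$. Then the limit defining the finite-part integral exists, and for every $0<d'<d$ the maximum $$\mathscr N(f,n,d')=\max_{|\operatorname{Im}w|=d'}\left|\varphi(w)^{-n}f(\varphi(w))\log\!\Big(\frac{\varphi(w)}{\varphi(w)-1}\Big)\varphi'(w)\right|$$ exists and, for every $N\ge1$, $$\left|\mathrm{f.p.}\!\int_0^1x^{-n}f(x)\,dx-I_N^{(n)}[f]\right|\le\frac{u_p}{\pi}\,\mathscr N(f,n,d')\,\frac{\exp(-2\pi d'N/u_p)}{1-\exp(-2\pi d'N/u_p)}.$$ Since $\mathscr N(f,n,d')$ does not depend on $N$, the convergence as $N\to\infty$ is exponential. -/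

import Mathlib

open Filter Topology Set

noncomputable section

/-- The closed interval `[0,1]` of the real axis, as a subset of the complex plane. -/
def unitSegment : Set ℂ := (fun x : ℝ => (x : ℂ)) '' Icc (0 : ℝ) 1

/-- The open strip `{w : |Im w| < d}`. -/
def strip (d : ℝ) : Set ℂ := {w : ℂ | |w.im| < d}

/-- The truncated integral of `x ^ (-n) * f x` with its divergent part removed:
`∫_ε^1 x^{-n} f(x) dx - ∑_{k=0}^{n-2} ε^{k+1-n} f^{(k)}(0) / (k! (n-1-k))
  + log ε * f^{(n-1)}(0) / (n-1)!`. For `n = 1` the sum is empty. -/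
def fpTruncated (n : ℕ) (f : ℂ → ℂ) (ε : ℝ) : ℂ :=
  (∫ x in ε..1, (x : ℂ) ^ (-(n : ℤ)) * f (x : ℂ))
    - ∑ k ∈ Finset.range (n - 1),
        (ε : ℂ) ^ ((k : ℤ) + 1 - (n : ℤ)) / ((k.factorial : ℂ) * ((n : ℂ) - 1 - (k : ℂ)))
          * iteratedDeriv k f 0
    + (Real.log ε : ℂ) / ((n - 1).factorial : ℂ) * iteratedDeriv (n - 1) f 0

/-- The Hadamard finite-part integral of `x ^ (-n) * f x` over `[0,1]`, for `1 ≤ n`: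
the limit of `fpTruncated n f ε` as `ε` decreases to `0`. -/
def fpIntegral (n : ℕ) (f : ℂ → ℂ) : ℂ :=
  limUnder (𝓝[>] (0 : ℝ)) (fpTruncated n f)

/-- The winding number about `a` of the closed curve `u ↦ φ u`, `0 ≤ u ≤ p`:
`(2πi)⁻¹ ∮ dz / (z - a)`. -/
def windingNumber (φ : ℂ → ℂ) (p : ℝ) (a : ℂ) : ℂ :=
  (2 * (Real.pi : ℂ) * Complex.I)⁻¹ * ∫ u in (0 : ℝ)..p, deriv φ (u : ℂ) / (φ (u : ℂ) - a)

/-- The integrand `φ(w)^{-n} f(φ(w)) log(φ(w) / (φ(w) - 1)) φ'(w)` of the parametrized loop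
integral, with the principal branch of the logarithm (`z ↦ log (z / (z - 1))` is then analytic
off `[0,1]`). -/
def loopIntegrand (n : ℕ) (f φ : ℂ → ℂ) (w : ℂ) : ℂ :=
  φ w ^ (-(n : ℤ)) * f (φ w) * Complex.log (φ w / (φ w - 1)) * deriv φ w

/-- The `N`-point trapezoidal approximation `I_N^{(n)}[f]`, with step `h = p / N`. -/
def trapezoidalFp (n : ℕ) (f φ : ℂ → ℂ) (p : ℝ) (N : ℕ) : ℂ :=
  ((p / N : ℝ) : ℂ) / (2 * (Real.pi : ℂ) * Complex.I)
      * ∑ k ∈ Finset.range N, loopIntegrand n f φ ((k * (p / N) : ℝ) : ℂ)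
    - ∑ k ∈ Finset.range (n - 1),
        iteratedDeriv k f 0 / ((k.factorial : ℂ) * ((n : ℂ) - 1 - (k : ℂ)))

/-- The moduli of the loop integrand on the two lines `|Im w| = d'`. -/
def loopModuli (n : ℕ) (f φ : ℂ → ℂ) (d' : ℝ) : Set ℝ :=
  (fun w : ℂ => ‖loopIntegrand n f φ w‖) '' {w : ℂ | |w.im| = d'}

/-- The largest modulus of the loop integrand on the two lines `|Im w| = d'`. -/
def loopNorm (n : ℕ) (f φ : ℂ → ℂ) (d' : ℝ) : ℝ :=
  sSup (loopModuli n f φ d')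

end

/-! Write `f` as its Taylor polynomial of degree `n - 1` at `0` plus `z ^ n * F z`, with `F`
analytic on `D`. Both the finite part and the loop integral see only `F`. On the segment, the
divergent terms cancel and leave `∫₀¹ F` minus the explicit finite sum (`fpTruncated_eq`). On the
loop, `log (z / (z - 1)) = ∫₀¹ dx / (z - x)`; after Fubini, the Taylor terms have cancelling
residues at `0` and `x`, while Cauchy's formula for `F` gives `2πi F x`
(`integral_loop_eq_integral_remainder`). As `D` need not be simply connected, that formula is needed
in its homology form, obtained by Dixon's argument.

So the finite part is an exact integral of a periodic function analytic in a strip, minus the same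
sum that occurs in `trapezoidalFp`, and the error is purely that of the trapezoidal rule. That error
is a sum of nonzero Fourier modes; moving the contour to `|Im w| = d'` makes them decay
geometrically (`norm_integral_sub_trapezoidal_le`). -/

/-! ### Analytic parameter integrals and divided differences. -/

/-- Joint continuity suffices: Cauchy's estimate turns a local bound on `K` into the domination of
its `w`-derivative. -/
theorem differentiableOn_intervalIntegral_param {U : Set ℂ} (hU : IsOpen U) {K : ℂ → ℝ → ℂ}
    {a b : ℝ} (hK : ContinuousOn (Function.uncurry K) (U ×ˢ univ))
    (hd : ∀ t, DifferentiableOn ℂ (fun w => K w t) U) :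
    DifferentiableOn ℂ (fun w => ∫ t in a..b, K w t) U := by
  intro w₀ hw₀
  obtain ⟨R, hR, hRU⟩ := Metric.nhds_basis_closedBall.mem_iff.1 (hU.mem_nhds hw₀)
  have hcont : ∀ w ∈ U, Continuous (K w) := fun w hw =>
    hK.comp_continuous (f := fun t : ℝ => (w, t)) (by fun_prop) (fun t => ⟨hw, mem_univ _⟩)
  obtain ⟨M, hM⟩ := ((isCompact_closedBall w₀ R).prod
    (isCompact_uIcc (a := a) (b := b))).exists_bound_of_continuousOn
    (hK.mono (prod_mono hRU (subset_univ _)))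
  have hR2 : 0 < R / 2 := by positivity
  have hsub : Metric.ball w₀ (R / 2) ⊆ U := fun w hw =>
    hRU (Metric.closedBall_subset_closedBall (by linarith) (Metric.ball_subset_closedBall hw))
  have hder : ∀ t, ∀ w ∈ U, HasDerivAt (fun w => K w t) (deriv (fun w => K w t) w) w :=
    fun t w hw => ((hd t).differentiableAt (hU.mem_nhds hw)).hasDerivAt
  refine (intervalIntegral.hasDerivAt_integral_of_dominated_loc_of_deriv_le
    (F := K) (F' := fun w t => deriv (fun w => K w t) w) (bound := fun _ => M / (R / 2))
    (Metric.ball_mem_nhds w₀ hR2) ?_ ?_ ?_ ?_ ?_ ?_).2.differentiableAt.differentiableWithinAt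
  · filter_upwards [hU.mem_nhds hw₀] with w hw
    exact (hcont w hw).aestronglyMeasurable
  · exact (hcont w₀ hw₀).intervalIntegrable _ _
  -- The derivative is measurable in `t` as a pointwise limit of difference quotients continuous in
  -- `t`.
  · obtain ⟨s, hs0, hs⟩ : ∃ s : ℕ → ℂ, (∀ n, s n ∈ U ∧ s n ≠ w₀) ∧ Tendsto s atTop (𝓝 w₀) := by
      obtain ⟨s, hs⟩ := exists_seq_tendsto (𝓝[≠] w₀)
      have h1 := tendsto_nhdsWithin_iff.1 hs
      obtain ⟨N, hN⟩ := eventually_atTop.1 ((h1.1.eventually (hU.mem_nhds hw₀)).and h1.2)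
      exact ⟨fun n => s (n + N), fun n => hN _ (by omega), h1.1.comp (tendsto_add_atTop_nat N)⟩
    refine aestronglyMeasurable_of_tendsto_ae atTop
      (f := fun n t => slope (fun w => K w t) w₀ (s n)) (fun n => ?_)
      (MeasureTheory.ae_of_all _ fun t => ?_)
    · simp only [slope_def_field]
      exact (((hcont _ (hs0 n).1).sub (hcont _ hw₀)).div_const _).aestronglyMeasurable
    · exact (hasDerivAt_iff_tendsto_slope.1 (hder t w₀ hw₀)).comp
        (tendsto_nhdsWithin_iff.2 ⟨hs, Eventually.of_forall fun n => (hs0 n).2⟩)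
  · refine MeasureTheory.ae_of_all _ fun t ht w hw => ?_
    have hcb : Metric.closedBall w (R / 2) ⊆ Metric.closedBall w₀ R := by
      intro z hz
      rw [Metric.mem_closedBall] at hz ⊢
      have := Metric.mem_ball.1 hw
      linarith [dist_triangle z w w₀]
    refine Complex.norm_deriv_le_of_forall_mem_sphere_norm_le hR2 ?_ fun z hz =>
      hM (z, t) ⟨hcb (Metric.sphere_subset_closedBall hz), uIoc_subset_uIcc ht⟩
    refine DifferentiableOn.diffContOnCl ?_
    rw [closure_ball _ hR2.ne']
    exact (hd t).mono (hcb.trans hRU)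
  · exact intervalIntegrable_const
  · exact MeasureTheory.ae_of_all _ fun t _ w hw => hder t w (hsub hw)

theorem dslope_swap (F : ℂ → ℂ) (z w : ℂ) : dslope F z w = dslope F w z := by
  rcases eq_or_ne w z with rfl | h
  · rfl
  · rw [dslope_of_ne _ h, dslope_of_ne _ h.symm, slope_comm]

/-- On the diagonal, strict differentiability controls nearby pairs of distinct points, and
continuity of `deriv F` the nearby diagonal points. -/
theorem continuousOn_uncurry_dslope {D : Set ℂ} {F : ℂ → ℂ} (hF : AnalyticOnNhd ℂ F D) :
    ContinuousOn (fun q : ℂ × ℂ => dslope F q.1 q.2) (D ×ˢ D) := by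
  rintro ⟨z, w⟩ ⟨hz, hw⟩
  refine ContinuousAt.continuousWithinAt ?_
  by_cases h : w = z
  · subst h
    have hstrict : HasStrictDerivAt F (deriv F w) w := (hF w hw).hasStrictDerivAt
    have hderiv : ContinuousAt (deriv F) w := (hF w hw).deriv.continuousAt
    rw [Metric.continuousAt_iff']
    intro ε hε
    have h1 := hstrict.isLittleO.def (half_pos hε)
    have h2 : ∀ᶠ q : ℂ × ℂ in 𝓝 (w, w), dist (deriv F q.1) (deriv F w) < ε :=
      (Metric.continuousAt_iff'.1 hderiv ε hε).prod_inl_nhds w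
    filter_upwards [h1, h2] with q hq1 hq2
    simp only [dslope_same]
    by_cases hq : q.2 = q.1
    · rw [hq, dslope_same]; exact hq2
    · rw [dslope_swap, dslope_of_ne _ (Ne.symm hq), slope_def_field, dist_eq_norm]
      have hne : q.1 - q.2 ≠ 0 := sub_ne_zero.2 (Ne.symm hq)
      have hpos : 0 < ‖q.1 - q.2‖ := norm_pos_iff.2 hne
      have : (F q.1 - F q.2) / (q.1 - q.2) - deriv F w
          = (F q.1 - F q.2 - (q.1 - q.2) * deriv F w) / (q.1 - q.2) := by
        field_simp
      rw [this, norm_div]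
      have h3 : ‖F q.1 - F q.2 - (q.1 - q.2) * deriv F w‖ ≤ ε / 2 * ‖q.1 - q.2‖ := by
        simpa [mul_comm] using hq1
      calc _ ≤ ε / 2 := (div_le_iff₀ hpos).2 h3
        _ < ε := by linarith
  · have hev : (fun q : ℂ × ℂ => dslope F q.1 q.2)
        =ᶠ[𝓝 (z, w)] fun q => (F q.2 - F q.1) / (q.2 - q.1) := by
      have : ∀ᶠ q : ℂ × ℂ in 𝓝 (z, w), q.2 ≠ q.1 :=
        (isOpen_ne_fun continuous_snd continuous_fst).mem_nhds h
      filter_upwards [this] with q hq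
      rw [dslope_of_ne _ hq, slope_def_field]
    refine ContinuousAt.congr ?_ hev.symm
    have h1 : ContinuousAt (fun q : ℂ × ℂ => F q.1) (z, w) :=
      ContinuousAt.comp (g := F) (hF z hz).continuousAt continuousAt_fst
    have h2 : ContinuousAt (fun q : ℂ × ℂ => F q.2) (z, w) :=
      ContinuousAt.comp (g := F) (hF w hw).continuousAt continuousAt_snd
    exact (h2.sub h1).div (continuousAt_snd.sub continuousAt_fst) (sub_ne_zero.2 h)

/-! ### Winding numbers and Cauchy's formula in homology form. -/

section ClosedCurve

variable {γ γ' : ℝ → ℂ} {p : ℝ}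

/-- The quotient `(γ - w) / (γ - w₀)` stays within distance `1` of `1`, so its principal logarithm
is a primitive of the difference of the integrands. Hence winding numbers are locally constant. -/
theorem integral_logDeriv_sub_eq_of_near (hγ : ∀ u, HasDerivAt γ (γ' u) u) (hγ' : Continuous γ')
    (hclosed : γ p = γ 0) {w w₀ : ℂ} (hnear : ∀ u, ‖w - w₀‖ < ‖γ u - w₀‖) :
    ∫ u in (0 : ℝ)..p, γ' u / (γ u - w) = ∫ u in (0 : ℝ)..p, γ' u / (γ u - w₀) := by
  have hc : Continuous γ := continuous_iff_continuousAt.2 fun u => (hγ u).continuousAt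
  have h0 : ∀ u, γ u - w₀ ≠ 0 := fun u h => by
    have := hnear u; rw [h, norm_zero] at this; exact absurd this (not_lt.2 (norm_nonneg _))
  have h1 : ∀ u, γ u - w ≠ 0 := fun u h => by
    have := hnear u; rw [sub_eq_zero.1 h] at this; exact lt_irrefl _ this
  have hi0 : Continuous fun u => γ' u / (γ u - w₀) := hγ'.div (hc.sub continuous_const) h0
  have hi1 : Continuous fun u => γ' u / (γ u - w) := hγ'.div (hc.sub continuous_const) h1
  rw [← sub_eq_zero, ← intervalIntegral.integral_sub (hi1.intervalIntegrable _ _)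
    (hi0.intervalIntegrable _ _)]
  have hslit : ∀ u, (γ u - w) / (γ u - w₀) ∈ Complex.slitPlane := fun u => by
    have : (γ u - w) / (γ u - w₀) = 1 + (-((w - w₀) / (γ u - w₀))) := by
      field_simp [h0 u]; ring
    rw [this]
    refine Complex.mem_slitPlane_of_norm_lt_one ?_
    rw [norm_neg, norm_div]
    exact (div_lt_one (norm_pos_iff.2 (h0 u))).2 (hnear u)
  have hderiv : ∀ u, HasDerivAt (fun u => Complex.log ((γ u - w) / (γ u - w₀)))
      (γ' u / (γ u - w) - γ' u / (γ u - w₀)) u := fun u => by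
    have := (((hγ u).sub_const w).fun_div ((hγ u).sub_const w₀) (h0 u)).clog_real (hslit u)
    convert this using 1
    have := h0 u
    have := h1 u
    field_simp
  rw [intervalIntegral.integral_eq_sub_of_hasDerivAt (fun u _ => hderiv u)
    ((hi1.sub hi0).intervalIntegrable _ _), hclosed, sub_self]

/-- Here `log (1 - γ / w)` is a primitive. -/
theorem integral_logDeriv_sub_eq_zero_of_far (hγ : ∀ u, HasDerivAt γ (γ' u) u)
    (hγ' : Continuous γ') (hclosed : γ p = γ 0) {w : ℂ} (hfar : ∀ u, ‖γ u‖ < ‖w‖) :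
    ∫ u in (0 : ℝ)..p, γ' u / (γ u - w) = 0 := by
  have hc : Continuous γ := continuous_iff_continuousAt.2 fun u => (hγ u).continuousAt
  have hw : w ≠ 0 := norm_pos_iff.1 ((norm_nonneg _).trans_lt (hfar 0))
  have h1 : ∀ u, γ u - w ≠ 0 := fun u h => by
    have := hfar u; rw [sub_eq_zero.1 h] at this; exact lt_irrefl _ this
  have hslit : ∀ u, 1 + (-(γ u / w)) ∈ Complex.slitPlane := fun u => by
    refine Complex.mem_slitPlane_of_norm_lt_one ?_
    rw [norm_neg, norm_div]
    exact (div_lt_one (norm_pos_iff.2 hw)).2 (hfar u)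
  have hderiv : ∀ u, HasDerivAt (fun u => Complex.log (1 + (-(γ u / w))))
      (γ' u / (γ u - w)) u := fun u => by
    have := ((((hγ u).div_const w).fun_neg).const_add 1).clog_real (hslit u)
    convert this using 1
    have h2 := h1 u
    have h4 : 1 + -(γ u / w) = - (γ u - w) / w := by field_simp; ring
    rw [h4]
    field_simp
  rw [intervalIntegral.integral_eq_sub_of_hasDerivAt (fun u _ => hderiv u)
    ((hγ'.div (hc.sub continuous_const) h1).intervalIntegrable _ _), hclosed, sub_self]

/-- **Cauchy's integral formula**, homology version, by Dixon's argument: if a closed curve in the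
open set `D` does not wind around any point outside `D`, then the integral of
`(F (γ u) - F a) / (γ u - a) * γ' u` vanishes for `F` analytic on `D`. -/
theorem integral_dslope_eq_zero_of_null_homologous
    (hγ : ∀ u, HasDerivAt γ (γ' u) u) (hγ' : Continuous γ') (hper : Function.Periodic γ p)
    (hp : 0 < p) {D : Set ℂ} (hD : IsOpen D) (hγD : ∀ u, γ u ∈ D)
    (hnull : ∀ a ∉ D, ∫ u in (0 : ℝ)..p, γ' u / (γ u - a) = 0)
    {F : ℂ → ℂ} (hF : AnalyticOnNhd ℂ F D) {a : ℂ} (ha : a ∈ D) :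
    ∫ u in (0 : ℝ)..p, dslope F a (γ u) * γ' u = 0 := by
  classical
  have hc : Continuous γ := continuous_iff_continuousAt.2 fun u => (hγ u).continuousAt
  have hclosed : γ p = γ 0 := by simpa using hper 0
  have hcpt : IsCompact (range γ) := hper.compact_of_continuous hp.ne' hc
  obtain ⟨R, hR⟩ := hcpt.isBounded.exists_norm_le
  have hFγ : Continuous fun u => F (γ u) := hF.continuousOn.comp_continuous hc hγD
  set G₁ : ℂ → ℂ := fun w => ∫ u in (0 : ℝ)..p, dslope F w (γ u) * γ' u with hG₁
  set G₂ : ℂ → ℂ := fun w => ∫ u in (0 : ℝ)..p, F (γ u) * γ' u / (γ u - w) with hG₂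
  -- `V` is open and covers the complement of `D`. On `D ∩ V`, `G₁` and `G₂` differ by `F w` times a
  -- vanishing winding integral, so they glue to an entire function.
  set V : Set ℂ := {w | w ∉ range γ ∧ ∫ u in (0 : ℝ)..p, γ' u / (γ u - w) = 0} with hV
  have hDV : ∀ w, w ∉ D → w ∈ V := fun w hw =>
    ⟨fun ⟨u, hu⟩ => hw (hu ▸ hγD u), hnull w hw⟩
  have hVopen : IsOpen V := by
    rw [Metric.isOpen_iff]
    rintro w₀ ⟨hw₀, h0⟩
    obtain ⟨r, hr, hball⟩ := Metric.isOpen_iff.1 hcpt.isClosed.isOpen_compl w₀ hw₀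
    refine ⟨r, hr, fun w hw => ⟨hball hw, ?_⟩⟩
    rw [integral_logDeriv_sub_eq_of_near hγ hγ' hclosed (w₀ := w₀) (fun u => ?_), h0]
    rw [← dist_eq_norm, ← dist_eq_norm]
    refine (Metric.mem_ball.1 hw).trans_le (not_lt.1 fun hlt => ?_)
    exact hball (Metric.mem_ball.2 hlt) ⟨u, rfl⟩
  have heq : ∀ w ∈ D, w ∈ V → G₁ w = G₂ w := by
    rintro w hwD ⟨hw, h0⟩
    have hne : ∀ u, γ u - w ≠ 0 := fun u h => hw ⟨u, sub_eq_zero.1 h⟩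
    have : ∀ u, dslope F w (γ u) * γ' u
        = F (γ u) * γ' u / (γ u - w) - F w * (γ' u / (γ u - w)) := fun u => by
      rw [dslope_of_ne _ (sub_ne_zero.1 (hne u)), slope_def_field]
      ring
    simp only [hG₁, hG₂, this]
    rw [intervalIntegral.integral_sub, intervalIntegral.integral_const_mul, h0, mul_zero, sub_zero]
    · exact ((hFγ.mul hγ').div (hc.sub continuous_const) hne).intervalIntegrable _ _
    · exact (continuous_const.mul (hγ'.div (hc.sub continuous_const) hne)).intervalIntegrable _ _
  have hd₁ : DifferentiableOn ℂ G₁ D := by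
    refine differentiableOn_intervalIntegral_param hD ?_ fun u => ?_
    · refine ContinuousOn.mul ?_ (hγ'.comp continuous_snd).continuousOn
      exact (continuousOn_uncurry_dslope hF).comp (f := fun q : ℂ × ℝ => (q.1, γ q.2))
        (by fun_prop) fun q hq => ⟨hq.1, hγD _⟩
    · refine DifferentiableOn.mul_const ?_ _
      simp only [fun w => dslope_swap F w (γ u)]
      exact (Complex.differentiableOn_dslope (hD.mem_nhds (hγD u))).2 hF.differentiableOn
  have hd₂ : DifferentiableOn ℂ G₂ V := by
    refine differentiableOn_intervalIntegral_param hVopen ?_ fun u => ?_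
    · refine ContinuousOn.div ((hFγ.mul hγ').comp continuous_snd).continuousOn (by fun_prop) ?_
      rintro ⟨w, u⟩ ⟨⟨hw, -⟩, -⟩ h
      exact hw ⟨u, sub_eq_zero.1 h⟩
    · refine DifferentiableOn.div (by fun_prop) (by fun_prop) ?_
      rintro w ⟨hw, -⟩ h
      exact hw ⟨u, sub_eq_zero.1 h⟩
  set G : ℂ → ℂ := fun w => if w ∈ D then G₁ w else G₂ w with hG
  have hGV : ∀ w ∈ V, G w = G₂ w := fun w hw => by
    by_cases hwD : w ∈ D
    · simp only [hG, if_pos hwD, heq w hwD hw]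
    · simp only [hG, if_neg hwD]
  have hdiff : Differentiable ℂ G := fun w => by
    by_cases hwD : w ∈ D
    · refine (hd₁.differentiableAt (hD.mem_nhds hwD)).congr_of_eventuallyEq ?_
      filter_upwards [hD.mem_nhds hwD] with z hz
      simp only [hG, if_pos hz]
    · refine (hd₂.differentiableAt (hVopen.mem_nhds (hDV w hwD))).congr_of_eventuallyEq ?_
      filter_upwards [hVopen.mem_nhds (hDV w hwD)] with z hz using hGV z hz
  obtain ⟨B, hB⟩ := (isCompact_uIcc (a := (0:ℝ)) (b := p)).exists_bound_of_continuousOn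
    (hFγ.mul hγ').continuousOn
  -- Far points lie in `V`, where `G = G₂` decays; Liouville then forces `G = 0`.
  have hlim : Tendsto G (cocompact ℂ) (𝓝 0) := by
    have hmaj : Tendsto (fun w : ℂ => B / (‖w‖ - R) * |p - 0|) (cocompact ℂ) (𝓝 0) := by
      have h1 : Tendsto (fun w : ℂ => ‖w‖ - R) (cocompact ℂ) atTop :=
        tendsto_atTop_add_const_right _ _ (tendsto_norm_cocompact_atTop (E := ℂ))
      simpa using (h1.const_div_atTop B).mul_const |p - 0|
    refine squeeze_zero_norm' ?_ hmaj
    filter_upwards [(tendsto_norm_cocompact_atTop (E := ℂ)).eventually_gt_atTop R] with w hw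
    have hlt : ∀ u, ‖γ u‖ < ‖w‖ := fun u => (hR _ ⟨u, rfl⟩).trans_lt hw
    have hwV : w ∈ V := ⟨fun ⟨u, hu⟩ => (hu ▸ hlt u).false,
      integral_logDeriv_sub_eq_zero_of_far hγ hγ' hclosed hlt⟩
    rw [hGV w hwV]
    refine intervalIntegral.norm_integral_le_of_norm_le_const fun u hu => ?_
    rw [norm_div]
    have hBu := hB u (uIoc_subset_uIcc hu)
    refine div_le_div₀ ((norm_nonneg _).trans hBu) hBu (sub_pos.2 hw) ?_
    have := norm_sub_norm_le w (γ u)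
    rw [norm_sub_rev] at this
    linarith [hR _ ⟨u, rfl⟩]
  have := hdiff.apply_eq_of_tendsto_cocompact a hlim
  simpa only [hG, if_pos ha] using this

end ClosedCurve

/-! ### Taylor remainder and finite part. -/

/-- Taylor expansion at `0` with an analytic remainder. -/
theorem exists_analyticOnNhd_taylor_remainder {D : Set ℂ} (hD : IsOpen D) (h0 : (0 : ℂ) ∈ D)
    {f : ℂ → ℂ} (hf : AnalyticOnNhd ℂ f D) (n : ℕ) :
    ∃ F : ℂ → ℂ, AnalyticOnNhd ℂ F D ∧ ∀ z, f z
      = ∑ k ∈ Finset.range n, iteratedDeriv k f 0 / (k.factorial : ℂ) * z ^ k + z ^ n * F z := by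
  -- Each divided difference at `0` removes the constant term and divides by `z`, the singularity
  -- being removable.
  refine ⟨(Function.swap dslope 0)^[n] f, ?_, ?_⟩
  · induction n with
    | zero => simpa using hf
    | succ n ih =>
      rw [Function.iterate_succ_apply']
      rw [Complex.analyticOnNhd_iff_differentiableOn hD] at ih ⊢
      exact (Complex.differentiableOn_dslope (hD.mem_nhds h0)).2 ih
  · induction n with
    | zero => simp
    | succ n ih =>
      intro z
      have hp := (hf 0 h0).hasFPowerSeriesAt
      have hcoeff : (Function.swap dslope 0)^[n] f 0 = iteratedDeriv n f 0 / (n.factorial : ℂ) := by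
        rw [← (hp.has_fpower_series_iterate_dslope_fslope n).coeff_zero 1,
          ← FormalMultilinearSeries.coeff, FormalMultilinearSeries.coeff_iterate_fslope, zero_add,
          FormalMultilinearSeries.coeff_ofScalars]
      have hs := sub_smul_dslope ((Function.swap dslope 0)^[n] f) 0 z
      rw [hcoeff, sub_zero, smul_eq_mul] at hs
      rw [ih z, Finset.sum_range_succ, Function.iterate_succ_apply', pow_succ]
      simp only [Function.swap] at hs ⊢
      linear_combination (-z ^ n) * hs

theorem ofReal_mem_unitSegment {x : ℝ} (hx : x ∈ Icc (0 : ℝ) 1) : (x : ℂ) ∈ unitSegment :=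
  ⟨x, hx, rfl⟩

theorem integral_ofReal_zpow {ε : ℝ} (hε : 0 < ε) {j : ℤ} (hj : j ≠ -1) :
    ∫ x in ε..1, (x : ℂ) ^ j = (1 - (ε : ℂ) ^ (j + 1)) / (j + 1) := by
  have h := integral_zpow (a := ε) (b := 1) (n := j)
    (Or.inr ⟨hj, notMem_uIcc_of_lt hε one_pos⟩)
  have h2 : ∫ x in ε..1, (x : ℂ) ^ j = ((∫ x in ε..1, x ^ j : ℝ) : ℂ) := by
    rw [← intervalIntegral.integral_ofReal]; push_cast; rfl
  rw [h2, h]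
  push_cast
  simp

theorem integral_ofReal_inv {ε : ℝ} (hε : 0 < ε) :
    ∫ x in ε..1, (x : ℂ) ^ (-1 : ℤ) = -(Real.log ε : ℂ) := by
  have h2 : ∫ x in ε..1, (x : ℂ) ^ (-1 : ℤ) = ((∫ x in ε..1, x⁻¹ : ℝ) : ℂ) := by
    rw [← intervalIntegral.integral_ofReal]; push_cast; simp
  rw [h2, integral_inv_of_pos hε one_pos, one_div, Real.log_inv]
  push_cast; rfl

/-- Termwise integration of `x ^ (k - n)`: for `k < n - 1` the lower endpoint gives the subtracted
power of `ε` and the upper one the finite sum; `k = n - 1` gives `-log ε`, cancelled by the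
logarithmic correction. -/
theorem fpTruncated_eq {D : Set ℂ} (hsegD : unitSegment ⊆ D) {f F : ℂ → ℂ} {n : ℕ} (hn : 1 ≤ n)
    (hF : AnalyticOnNhd ℂ F D)
    (hfF : ∀ z, f z = ∑ k ∈ Finset.range n, iteratedDeriv k f 0 / (k.factorial : ℂ) * z ^ k
      + z ^ n * F z) {ε : ℝ} (hε : 0 < ε) (hε1 : ε ≤ 1) :
    fpTruncated n f ε = (∫ x in ε..1, F x) - ∑ k ∈ Finset.range (n - 1),
        iteratedDeriv k f 0 / ((k.factorial : ℂ) * ((n : ℂ) - 1 - (k : ℂ))) := by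
  obtain ⟨m, rfl⟩ : ∃ m, n = m + 1 := ⟨n - 1, by omega⟩
  have hpos : ∀ x ∈ uIcc ε 1, 0 < x ∧ x ≤ 1 := fun x hx => by
    rw [uIcc_of_le hε1] at hx; exact ⟨hε.trans_le hx.1, hx.2⟩
  have hz : ∀ j : ℤ, IntervalIntegrable (fun x : ℝ => (x : ℂ) ^ j) MeasureTheory.volume ε 1 :=
    fun j => ContinuousOn.intervalIntegrable fun x hx =>
      ((continuousAt_zpow₀ (x : ℂ) j (Or.inl (by exact_mod_cast (hpos x hx).1.ne'))).comp
        Complex.continuous_ofReal.continuousAt).continuousWithinAt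
  have hFi : IntervalIntegrable (fun x : ℝ => F x) MeasureTheory.volume ε 1 :=
    ContinuousOn.intervalIntegrable (hF.continuousOn.comp Complex.continuous_ofReal.continuousOn
      fun x hx => hsegD (ofReal_mem_unitSegment ⟨(hpos x hx).1.le, (hpos x hx).2⟩))
  have hint : ∫ x in ε..1, (x : ℂ) ^ (-((m + 1 : ℕ) : ℤ)) * f x
      = ∑ k ∈ Finset.range (m + 1), iteratedDeriv k f 0 / (k.factorial : ℂ)
          * (∫ x in ε..1, (x : ℂ) ^ ((k : ℤ) - (m + 1))) + ∫ x in ε..1, F x := by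
    have e : ∀ x ∈ uIcc ε 1, (x : ℂ) ^ (-((m + 1 : ℕ) : ℤ)) * f x
        = ∑ k ∈ Finset.range (m + 1), iteratedDeriv k f 0 / (k.factorial : ℂ)
          * (x : ℂ) ^ ((k : ℤ) - (m + 1)) + F x := fun x hx => by
      have hx0 : (x : ℂ) ≠ 0 := by exact_mod_cast (hpos x hx).1.ne'
      rw [hfF x, mul_add, Finset.mul_sum]
      congr 1
      · refine Finset.sum_congr rfl fun k _ => ?_
        rw [sub_eq_add_neg, zpow_add₀ hx0, zpow_natCast]
        push_cast; ring
      · rw [← mul_assoc, zpow_neg, zpow_natCast, inv_mul_cancel₀ (pow_ne_zero _ hx0), one_mul]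
    rw [intervalIntegral.integral_congr e, intervalIntegral.integral_add _ hFi,
      intervalIntegral.integral_finsetSum]
    · simp only [intervalIntegral.integral_const_mul]
    · exact fun k _ => (hz _).const_mul _
    · have := IntervalIntegrable.sum (Finset.range (m + 1)) fun k _ =>
        (hz ((k : ℤ) - (m + 1))).const_mul (iteratedDeriv k f 0 / (k.factorial : ℂ))
      simpa only [← Finset.sum_fn] using this
  rw [fpTruncated, hint, Finset.sum_range_succ, Nat.add_sub_cancel]
  have elast : ∫ x in ε..1, (x : ℂ) ^ ((m : ℤ) - (m + 1)) = -(Real.log ε : ℂ) := by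
    rw [← integral_ofReal_inv hε]; congr! 3; ring
  have esum : ∑ k ∈ Finset.range m, iteratedDeriv k f 0 / (k.factorial : ℂ)
        * ∫ x in ε..1, (x : ℂ) ^ ((k : ℤ) - (m + 1))
      = ∑ k ∈ Finset.range m, (ε : ℂ) ^ ((k : ℤ) + 1 - ((m + 1 : ℕ) : ℤ))
          / ((k.factorial : ℂ) * (((m + 1 : ℕ) : ℂ) - 1 - (k : ℂ))) * iteratedDeriv k f 0
        - ∑ k ∈ Finset.range m,
          iteratedDeriv k f 0 / ((k.factorial : ℂ) * (((m + 1 : ℕ) : ℂ) - 1 - (k : ℂ))) := by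
    rw [← Finset.sum_sub_distrib]
    refine Finset.sum_congr rfl fun k hk => ?_
    have hk' := Finset.mem_range.1 hk
    rw [integral_ofReal_zpow hε (by omega)]
    have e1 : (k : ℤ) + 1 - ((m + 1 : ℕ) : ℤ) = (k : ℤ) - (m + 1) + 1 := by push_cast; ring
    rw [e1]
    have h1 : (k.factorial : ℂ) ≠ 0 := by exact_mod_cast k.factorial_ne_zero
    have h2 : (m : ℂ) - k ≠ 0 := sub_ne_zero.2 (by exact_mod_cast hk'.ne')
    have h3 : ((((k : ℤ) - (m + 1) : ℤ) : ℂ) + 1) = -((m : ℂ) - k) := by push_cast; ring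
    have h4 : ((m + 1 : ℕ) : ℂ) - 1 - k = (m : ℂ) - k := by push_cast; ring
    rw [h3, h4]
    field_simp
    ring
  rw [esum, elast]
  ring

/-! ### The logarithm as a Cauchy integral over the segment. -/

/-- If `1 - x / z` were a real `t ≤ 0`, then `z = x / (1 - t)` would lie in `[0,1]`. -/
theorem one_sub_div_mem_slitPlane {z : ℂ} (hz : z ∉ unitSegment) {x : ℝ}
    (hx : x ∈ Icc (0 : ℝ) 1) : 1 - (x : ℂ) / z ∈ Complex.slitPlane := by
  have hz0 : z ≠ 0 := fun h => hz (h ▸ by simpa using ofReal_mem_unitSegment (x := 0) (by simp))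
  rw [Complex.mem_slitPlane_iff_not_le_zero]
  intro hle
  obtain ⟨hre, him⟩ := Complex.le_def.1 hle
  simp only [Complex.zero_re, Complex.zero_im] at hre him
  set t := (1 - (x : ℂ) / z).re with ht
  have heq : 1 - (x : ℂ) / z = (t : ℂ) := Complex.ext (by simp [ht]) (by simp [him])
  have h1 : (x : ℂ) = ((1 - t : ℝ) : ℂ) * z := by
    have : (x : ℂ) / z = ((1 - t : ℝ) : ℂ) := by push_cast; rw [← heq]; ring
    rw [← this]; field_simp
  have ht1 : 0 < 1 - t := by linarith
  refine hz ⟨x / (1 - t), ⟨div_nonneg hx.1 ht1.le, (div_le_one ht1).2 (by linarith [hx.2])⟩, ?_⟩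
  have : ((1 - t : ℝ) : ℂ) ≠ 0 := by exact_mod_cast ht1.ne'
  simp only [Complex.ofReal_div]
  rw [h1]; field_simp

theorem div_sub_one_mem_slitPlane {z : ℂ} (hz : z ∉ unitSegment) :
    z / (z - 1) ∈ Complex.slitPlane := by
  have h := one_sub_div_mem_slitPlane hz (x := 1) (by simp)
  have hz0 : z ≠ 0 := fun h => hz (h ▸ by simpa using ofReal_mem_unitSegment (x := 0) (by simp))
  have e : z / (z - 1) = (1 - ((1 : ℝ) : ℂ) / z)⁻¹ := by
    rw [Complex.ofReal_one, one_sub_div hz0, inv_div]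
  rw [e]
  rw [Complex.mem_slitPlane_iff_arg] at h ⊢
  refine ⟨?_, inv_ne_zero h.2⟩
  rw [Complex.arg_inv, if_neg h.1]
  exact fun h' => (Complex.neg_pi_lt_arg (1 - ((1 : ℝ) : ℂ) / z)).ne' (neg_eq_iff_eq_neg.1 h')

/-- The primitive `-log (1 - x / z)` never meets the branch cut, vanishes at `x = 0`, and at `x = 1`
equals the principal value wanted. -/
theorem integral_inv_sub_eq_log {z : ℂ} (hz : z ∉ unitSegment) :
    ∫ x in (0 : ℝ)..1, (z - x)⁻¹ = Complex.log (z / (z - 1)) := by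
  have hz0 : z ≠ 0 := fun h => hz (h ▸ by simpa using ofReal_mem_unitSegment (x := 0) (by simp))
  have hne : ∀ x ∈ Icc (0 : ℝ) 1, z - (x : ℂ) ≠ 0 := fun x hx h =>
    hz (sub_eq_zero.1 h ▸ ofReal_mem_unitSegment hx)
  have hderiv : ∀ x ∈ uIcc (0 : ℝ) 1,
      HasDerivAt (fun x : ℝ => -Complex.log (1 - (x : ℂ) / z)) ((z - x)⁻¹) x := fun x hx => by
    rw [uIcc_of_le zero_le_one] at hx
    have h := ((((Complex.ofRealCLM.hasDerivAt (x := x)).div_const z).const_sub 1).clog_real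
      (one_sub_div_mem_slitPlane hz hx)).fun_neg
    simp only [Complex.ofRealCLM_apply, Complex.ofReal_one] at h
    refine h.congr_deriv ?_
    have := hne x hx
    rw [one_sub_div hz0]
    field_simp
  rw [intervalIntegral.integral_eq_sub_of_hasDerivAt hderiv]
  · have h := one_sub_div_mem_slitPlane hz (x := 1) (by simp)
    have e : z / (z - 1) = (1 - ((1 : ℝ) : ℂ) / z)⁻¹ := by
      rw [Complex.ofReal_one, one_sub_div hz0, inv_div]
    rw [e, Complex.log_inv _ (Complex.slitPlane_arg_ne_pi h)]
    simp
  · refine ContinuousOn.intervalIntegrable (ContinuousOn.inv₀ (by fun_prop) fun x hx => ?_)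
    rw [uIcc_of_le zero_le_one] at hx
    exact hne x hx

/-! ### Reduction of the loop integral to the segment. -/

section ClosedCurve

variable {γ γ' : ℝ → ℂ} {p : ℝ}

/-- The residues at `0` and `x` are opposite and the curve winds equally around both. The induction
uses partial fractions: the extra term `z ^ (-(j + 2))` has a single-valued primitive, and the base
case is the equality of winding integrals. -/
theorem integral_pole_at_zero_div_sub_eq_zero (hγ : ∀ u, HasDerivAt γ (γ' u) u)
    (hγ' : Continuous γ') (hclosed : γ p = γ 0) (h0 : ∀ u, γ u ≠ 0) {x : ℂ} (hx : x ≠ 0)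
    (hne : ∀ u, γ u - x ≠ 0)
    (hw : ∫ u in (0 : ℝ)..p, γ' u / (γ u - x) = ∫ u in (0 : ℝ)..p, γ' u / γ u) (j : ℕ) :
    ∫ u in (0 : ℝ)..p, (γ u ^ (j + 1))⁻¹ * (γ' u / (γ u - x)) = 0 := by
  have hc : Continuous γ := continuous_iff_continuousAt.2 fun u => (hγ u).continuousAt
  have hi : Continuous fun u => γ' u / (γ u - x) := hγ'.div (hc.sub continuous_const) hne
  have hip : ∀ k : ℕ, Continuous fun u => (γ u ^ k)⁻¹ := fun k =>
    (hc.pow k).inv₀ fun u => pow_ne_zero _ (h0 u)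
  have hstep : ∀ k : ℕ, ∫ u in (0 : ℝ)..p, (γ u ^ (k + 1))⁻¹ * (γ' u / (γ u - x))
      = x⁻¹ * ((∫ u in (0 : ℝ)..p, (γ u ^ k)⁻¹ * (γ' u / (γ u - x)))
        - ∫ u in (0 : ℝ)..p, (γ u ^ (k + 1))⁻¹ * γ' u) := fun k => by
    rw [← intervalIntegral.integral_sub, ← intervalIntegral.integral_const_mul]
    · refine intervalIntegral.integral_congr fun u _ => ?_
      have h1 := h0 u
      have h2 := hne u
      field_simp
      ring
    · exact ((hip k).mul hi).intervalIntegrable _ _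
    · exact ((hip _).mul hγ').intervalIntegrable _ _
  induction j with
  | zero =>
    rw [hstep 0]
    simp only [pow_zero, inv_one, one_mul, zero_add, pow_one, hw]
    rw [sub_eq_zero.2, mul_zero]
    exact intervalIntegral.integral_congr fun u _ => div_eq_inv_mul _ _
  | succ j ih =>
    rw [hstep (j + 1), ih, zero_sub, mul_neg, neg_eq_zero]
    refine mul_eq_zero_of_right _ ?_
    have hderiv : ∀ u, HasDerivAt (fun u => -((j : ℂ) + 1)⁻¹ * (γ u ^ (j + 1))⁻¹)
        ((γ u ^ (j + 1 + 1))⁻¹ * γ' u) u := fun u => by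
      have h := (((hγ u).fun_pow (j + 1)).fun_inv (pow_ne_zero _ (h0 u))).const_mul
        (-((j : ℂ) + 1)⁻¹)
      refine h.congr_deriv ?_
      have h1 := h0 u
      have h2 : (j : ℂ) + 1 ≠ 0 := by exact_mod_cast j.succ_ne_zero
      push_cast
      field_simp
      ring
    rw [intervalIntegral.integral_eq_sub_of_hasDerivAt (fun u _ => hderiv u)
      (((hip _).mul hγ').intervalIntegrable _ _), hclosed, sub_self]

/-- The loop integral of `z ^ (-n) f(z) log (z / (z - 1))` reduces to the integral over `[0,1]` of
the Taylor remainder of `f`. -/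
theorem integral_loop_eq_integral_remainder
    (hγ : ∀ u, HasDerivAt γ (γ' u) u) (hγ' : Continuous γ') (hper : Function.Periodic γ p)
    (hp : 0 < p) {D : Set ℂ} (hD : IsOpen D) (hsegD : unitSegment ⊆ D) (hγD : ∀ u, γ u ∈ D)
    (hnull : ∀ a ∉ D, ∫ u in (0 : ℝ)..p, γ' u / (γ u - a) = 0)
    (hone : ∀ a ∈ unitSegment, ∫ u in (0 : ℝ)..p, γ' u / (γ u - a) = 2 * Real.pi * Complex.I)
    (hseg : ∀ u, γ u ∉ unitSegment) {f F : ℂ → ℂ} {n : ℕ}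
    (hf : AnalyticOnNhd ℂ f D) (hF : AnalyticOnNhd ℂ F D)
    (hfF : ∀ z, f z = ∑ k ∈ Finset.range n, iteratedDeriv k f 0 / (k.factorial : ℂ) * z ^ k
      + z ^ n * F z) :
    ∫ u in (0 : ℝ)..p, γ u ^ (-(n : ℤ)) * f (γ u) * Complex.log (γ u / (γ u - 1)) * γ' u
      = 2 * Real.pi * Complex.I * ∫ x in (0 : ℝ)..1, F x := by
  have hc : Continuous γ := continuous_iff_continuousAt.2 fun u => (hγ u).continuousAt
  have hclosed : γ p = γ 0 := by simpa using hper 0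
  have hne : ∀ x ∈ Icc (0 : ℝ) 1, ∀ u, γ u - (x : ℂ) ≠ 0 := fun x hx u h =>
    hseg u (sub_eq_zero.1 h ▸ ofReal_mem_unitSegment hx)
  have h0 : ∀ u, γ u ≠ 0 := fun u => by simpa using hne 0 (by simp) u
  have hfγ : Continuous fun u => f (γ u) := hf.continuousOn.comp_continuous hc hγD
  have hFγ : Continuous fun u => F (γ u) := hF.continuousOn.comp_continuous hc hγD
  have hz : Continuous fun u => γ u ^ (-(n : ℤ)) := hc.zpow₀ _ fun u => Or.inl (h0 u)
  -- The open interval keeps the poles at `0` and `x` distinct; endpoints do not affect the outer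
  -- integral.
  have hinner : ∀ x ∈ Ioo (0 : ℝ) 1,
      ∫ u in (0 : ℝ)..p, γ u ^ (-(n : ℤ)) * f (γ u) * γ' u * (γ u - x)⁻¹
        = 2 * Real.pi * Complex.I * F x := fun x hx => by
    have hxI := Ioo_subset_Icc_self hx
    have hx0 : (x : ℂ) ≠ 0 := by exact_mod_cast hx.1.ne'
    have hi : Continuous fun u => γ' u / (γ u - x) := hγ'.div (hc.sub continuous_const) (hne x hxI)
    have hi1 : ∀ k : ℕ, Continuous fun u => (γ u ^ k)⁻¹ * (γ' u / (γ u - x)) := fun k =>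
      ((hc.pow k).inv₀ fun u => pow_ne_zero _ (h0 u)).mul hi
    have hwx := hone x (ofReal_mem_unitSegment hxI)
    have hw0 := hone 0 (by simpa using ofReal_mem_unitSegment (x := 0) (by simp))
    simp only [sub_zero] at hw0
    have hcauchy := integral_dslope_eq_zero_of_null_homologous hγ hγ' hper hp hD hγD hnull hF
      (hsegD (ofReal_mem_unitSegment hxI))
    have hds : Continuous fun u => dslope F x (γ u) * γ' u := by
      refine Continuous.mul ?_ hγ'
      exact (continuousOn_uncurry_dslope hF).comp_continuous (f := fun u => ((x : ℂ), γ u))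
        (by fun_prop) fun u => ⟨hsegD (ofReal_mem_unitSegment hxI), hγD u⟩
    -- The Taylor terms integrate to zero, as does the `dslope` term; only `F x` times the winding
    -- integral survives. The exponent `n - 1 - k + 1` is `n - k`, kept visibly positive.
    have e : ∀ u, γ u ^ (-(n : ℤ)) * f (γ u) * γ' u * (γ u - x)⁻¹
        = ∑ k ∈ Finset.range n, iteratedDeriv k f 0 / (k.factorial : ℂ)
            * ((γ u ^ (n - 1 - k + 1))⁻¹ * (γ' u / (γ u - x)))
          + (dslope F x (γ u) * γ' u + F x * (γ' u / (γ u - x))) := fun u => by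
      have h1 := hne x hxI u
      have h2 := h0 u
      have hsum : ∀ k ∈ Finset.range n, iteratedDeriv k f 0 / (k.factorial : ℂ)
            * ((γ u ^ (n - 1 - k + 1))⁻¹ * (γ' u / (γ u - x)))
          = (γ' u / (γ u - x) * (γ u ^ n)⁻¹)
            * (iteratedDeriv k f 0 / (k.factorial : ℂ) * γ u ^ k) := fun k hk => by
        have hk' := Finset.mem_range.1 hk
        have : γ u ^ n = γ u ^ (n - 1 - k + 1) * γ u ^ k := by
          rw [← pow_add]; congr 1; omega
        rw [this]
        field_simp
      rw [Finset.sum_congr rfl hsum, ← Finset.mul_sum, dslope_of_ne _ (sub_ne_zero.1 h1),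
        slope_def_field, hfF (γ u), zpow_neg, zpow_natCast]
      field_simp
      ring
    rw [intervalIntegral.integral_congr fun u _ => e u, intervalIntegral.integral_add,
      intervalIntegral.integral_finsetSum, intervalIntegral.integral_add, hcauchy,
      intervalIntegral.integral_const_mul, hwx, Finset.sum_eq_zero]
    · ring
    · intro k _
      rw [intervalIntegral.integral_const_mul, integral_pole_at_zero_div_sub_eq_zero hγ hγ'
        hclosed h0 hx0 (hne x hxI) (hwx.trans hw0.symm), mul_zero]
    · exact hds.intervalIntegrable _ _
    · exact (continuous_const.mul hi).intervalIntegrable _ _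
    · exact fun k _ => (continuous_const.mul (hi1 _)).intervalIntegrable _ _
    · exact (continuous_finsetSum _ fun k _ => continuous_const.mul (hi1 _)).intervalIntegrable _ _
    · exact (hds.add (continuous_const.mul hi)).intervalIntegrable _ _
  have hlog : ∀ u, γ u ^ (-(n : ℤ)) * f (γ u) * Complex.log (γ u / (γ u - 1)) * γ' u
      = ∫ x in (0 : ℝ)..1, γ u ^ (-(n : ℤ)) * f (γ u) * γ' u * (γ u - x)⁻¹ := fun u => by
    rw [intervalIntegral.integral_const_mul, integral_inv_sub_eq_log (hseg u)]
    ring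
  rw [intervalIntegral.integral_congr fun u _ => hlog u,
    MeasureTheory.intervalIntegral_intervalIntegral_swap,
    intervalIntegral.integral_congr_Ioo_of_le zero_le_one hinner,
    intervalIntegral.integral_const_mul]
  have hcont : ContinuousOn (fun q : ℝ × ℝ => γ q.1 ^ (-(n : ℤ)) * f (γ q.1) * γ' q.1
      * (γ q.1 - q.2)⁻¹) (uIcc 0 p ×ˢ uIcc (0 : ℝ) 1) := by
    refine ContinuousOn.mul (((hz.mul hfγ).mul hγ').comp continuous_fst).continuousOn ?_
    refine ContinuousOn.inv₀ (by fun_prop) ?_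
    rintro ⟨u, x⟩ ⟨-, hx⟩
    rw [uIcc_of_le zero_le_one] at hx
    exact hne x hx u
  exact (hcont.integrableOn_compact (isCompact_uIcc.prod isCompact_uIcc)).mono_set
    (prod_mono uIoc_subset_uIcc uIoc_subset_uIcc)

end ClosedCurve

/-! ### The trapezoidal rule for periodic analytic functions. -/

theorem isOpen_strip (d : ℝ) : IsOpen (strip d) :=
  isOpen_lt (by fun_prop) continuous_const

theorem ofReal_mem_strip {d : ℝ} (hd : 0 < d) (u : ℝ) : (u : ℂ) ∈ strip d := by
  simpa [strip] using hd

theorem add_ofReal_mem_strip {d : ℝ} {w : ℂ} (hw : w ∈ strip d) (u : ℝ) : w + u ∈ strip d := by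
  simpa [strip] using hw

theorem ofReal_add_mul_I_mem_strip {d c : ℝ} (hc : |c| < d) (u : ℝ) :
    (u + c * Complex.I : ℂ) ∈ strip d := by
  simpa [strip] using hc

/-- Cauchy's theorem on a rectangle one period wide: the vertical sides cancel. -/
theorem intervalIntegral_shift_of_periodic {d h c : ℝ} {k : ℂ → ℂ}
    (hk : DifferentiableOn ℂ k (strip d)) (hper : ∀ w ∈ strip d, k (w + h) = k w)
    (hc : |c| < d) :
    ∫ u in (0 : ℝ)..h, k u = ∫ u in (0 : ℝ)..h, k (u + c * Complex.I) := by
  have key := Complex.integral_boundary_rect_eq_zero_of_differentiableOn k 0 (h + c * Complex.I)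
    (hk.mono ?_)
  · simp only [Complex.zero_re, Complex.zero_im, Complex.add_re, Complex.ofReal_re, Complex.mul_re,
      Complex.I_re, mul_zero, Complex.ofReal_im, Complex.I_im, mul_one, sub_self, add_zero,
      Complex.add_im, Complex.mul_im, zero_add, Complex.ofReal_zero, zero_mul] at key
    have hside : ∫ y in (0 : ℝ)..c, k (h + y * Complex.I)
        = ∫ y in (0 : ℝ)..c, k (y * Complex.I) := by
      refine intervalIntegral.integral_congr fun y hy => ?_
      have hy' : |y| < d := by
        have := abs_sub_left_of_mem_uIcc hy
        simp only [sub_zero] at this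
        exact this.trans_lt hc
      have := hper (y * Complex.I) (by simpa using ofReal_add_mul_I_mem_strip hy' 0)
      rw [← this, add_comm]
    rw [hside] at key
    linear_combination key
  · rintro w ⟨-, hw⟩
    have hw' : w.im ∈ uIcc 0 c := by simpa using hw
    have := abs_sub_left_of_mem_uIcc hw'
    simp only [sub_zero] at this
    exact this.trans_lt hc

theorem norm_integral_mul_exp_le {d d' h M : ℝ} {g : ℂ → ℂ} (hh : 0 < h)
    (hg : DifferentiableOn ℂ g (strip d)) (hper : ∀ w ∈ strip d, g (w + h) = g w)
    (hd'0 : 0 < d') (hd' : d' < d) (hM : ∀ w : ℂ, |w.im| = d' → ‖g w‖ ≤ M) (m : ℤ) :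
    ‖∫ u in (0 : ℝ)..h, Complex.exp (2 * Real.pi * Complex.I * m * u / h) * g u‖
      ≤ h * (M * Real.exp (-(2 * Real.pi * d' / h)) ^ m.natAbs) := by
  -- The shift takes the sign of `m`, so that the exponential decays in that direction.
  obtain ⟨c, hc, hcm⟩ : ∃ c : ℝ, |c| = d' ∧ (m : ℝ) * c = m.natAbs * d' := by
    rcases le_total 0 m with h0 | h0
    · refine ⟨d', abs_of_pos hd'0, ?_⟩
      rw [Nat.cast_natAbs, abs_of_nonneg h0]
    · refine ⟨-d', by rw [abs_neg, abs_of_pos hd'0], ?_⟩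
      rw [Nat.cast_natAbs, abs_of_nonpos h0]; push_cast; ring
  have hne : (h : ℂ) ≠ 0 := by exact_mod_cast hh.ne'
  have hshift := intervalIntegral_shift_of_periodic (h := h) (c := c)
    (k := fun w => Complex.exp (2 * Real.pi * Complex.I * m * w / h) * g w)
    (DifferentiableOn.mul (by fun_prop) hg) (fun w hw => by
      simp only [hper w hw]
      congr 1
      rw [Complex.exp_eq_exp_iff_exists_int]
      exact ⟨m, by field_simp⟩) (hc ▸ hd')
  rw [hshift]
  refine (intervalIntegral.norm_integral_le_of_norm_le_const
    (C := M * Real.exp (-(2 * Real.pi * d' / h)) ^ m.natAbs) fun u _ => ?_).trans_eq ?_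
  · rw [norm_mul, Complex.norm_exp, mul_comm, ← Real.exp_nat_mul]
    have hre : (2 * Real.pi * Complex.I * m * (u + c * Complex.I) / h : ℂ).re
        = m.natAbs * -(2 * Real.pi * d' / h) := by
      have : (2 * Real.pi * Complex.I * m * (u + c * Complex.I) / h : ℂ)
          = ((-(2 * Real.pi * (m * c) / h) : ℝ) : ℂ)
            + ((2 * Real.pi * m * u / h : ℝ) : ℂ) * Complex.I := by
        push_cast
        linear_combination (2 * Real.pi * m * c / h : ℂ) * Complex.I_mul_I
      rw [this, hcm]
      simp
      ring
    rw [hre]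
    exact mul_le_mul_of_nonneg_right (hM _ (by simpa using hc)) (Real.exp_pos _).le
  · rw [sub_zero, abs_of_pos hh, mul_comm]

/-- The value `g 0` is the sum of all Fourier coefficients, and the integral is `h` times the
zeroth. The rest is bounded by two geometric series, one for each sign of the frequency. -/
theorem norm_integral_sub_le_of_periodic_strip {d d' h M : ℝ} {g : ℂ → ℂ} (hh : 0 < h)
    (hg : DifferentiableOn ℂ g (strip d)) (hper : ∀ w ∈ strip d, g (w + h) = g w)
    (hd'0 : 0 < d') (hd' : d' < d) (hM : ∀ w : ℂ, |w.im| = d' → ‖g w‖ ≤ M) :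
    ‖(∫ u in (0 : ℝ)..h, g u) - h * g 0‖
      ≤ 2 * h * M * (Real.exp (-(2 * Real.pi * d' / h))
        / (1 - Real.exp (-(2 * Real.pi * d' / h)))) := by
  have hd : 0 < d := hd'0.trans hd'
  set q := Real.exp (-(2 * Real.pi * d' / h)) with hq
  have hq0 : 0 < q := Real.exp_pos _
  have hq1 : q < 1 := Real.exp_lt_one_iff.2 (neg_neg_of_pos (by positivity))
  have : Fact (0 < h) := ⟨hh⟩
  have hgr : Continuous fun u : ℝ => g u :=
    hg.continuousOn.comp_continuous Complex.continuous_ofReal (ofReal_mem_strip hd)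
  have hperR : Function.Periodic (fun u : ℝ => g u) h := fun u => by
    simpa using hper u (ofReal_mem_strip hd u)
  let F : C(AddCircle h, ℂ) := ⟨hperR.lift, hgr.quotient_liftOn' _⟩
  have hF : ∀ u : ℝ, F (u : AddCircle h) = g u := fun u => rfl
  have hcoeff : ∀ m : ℤ, fourierCoeff F m
      = (1 / h) • ∫ u in (0 : ℝ)..h,
          Complex.exp (2 * Real.pi * Complex.I * (-m : ℤ) * u / h) * g u := fun m => by
    rw [fourierCoeff_eq_intervalIntegral _ _ 0, zero_add]
    simp only [fourier_coe_apply, hF, smul_eq_mul]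
  have hbound : ∀ m : ℤ, ‖fourierCoeff F m‖ ≤ M * q ^ m.natAbs := fun m => by
    rw [hcoeff, norm_smul, Real.norm_of_nonneg (by positivity), one_div, inv_mul_le_iff₀ hh]
    simpa using norm_integral_mul_exp_le hh hg hper hd'0 hd' hM (-m)
  have hgeom : HasSum (fun k : ℕ => M * q ^ (k + 1)) (M * (q / (1 - q))) := by
    have := (hasSum_geometric_of_lt_one hq0.le hq1).mul_left (M * q)
    rw [mul_assoc, ← div_eq_mul_inv] at this
    simpa only [pow_succ', mul_assoc] using this
  have hpos : ∀ k : ℕ, ‖fourierCoeff F ((k : ℤ) + 1)‖ ≤ M * q ^ (k + 1) := fun k => by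
    exact hbound ((k : ℤ) + 1)
  have hneg : ∀ k : ℕ, ‖fourierCoeff F (-((k : ℤ) + 1))‖ ≤ M * q ^ (k + 1) := fun k => by
    have := hbound (-((k : ℤ) + 1))
    rwa [Int.natAbs_neg] at this
  have hsum1 := Summable.of_norm_bounded hgeom.summable hpos
  have hsum2 := Summable.of_norm_bounded hgeom.summable hneg
  have hsum := hsum1.hasSum.of_add_one_of_neg_add_one hsum2.hasSum
  have hpt := has_pointwise_sum_fourier_series_of_summable hsum.summable 0
  have hF0 : F 0 = g 0 := by simpa using hF 0
  simp only [fourier_eval_zero, smul_eq_mul, mul_one, hF0] at hpt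
  have heq := hsum.unique hpt
  have h0 : (h : ℂ) * fourierCoeff F 0 = ∫ u in (0 : ℝ)..h, g u := by
    have hne : (h : ℂ) ≠ 0 := by exact_mod_cast hh.ne'
    rw [hcoeff]
    simp [hne]
  rw [← h0, ← heq]
  have e : ∀ a b c : ℂ, (h : ℂ) * b - h * (a + b + c) = -(h * (a + c)) := fun a b c => by ring
  rw [e, norm_neg, norm_mul, Complex.norm_real, Real.norm_of_nonneg hh.le]
  calc _ ≤ h * (M * (q / (1 - q)) + M * (q / (1 - q))) := by
        gcongr
        exact (norm_add_le _ _).trans (add_le_add (tsum_of_norm_bounded hgeom hpos)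
          (tsum_of_norm_bounded hgeom hneg))
    _ = _ := by ring

/-- Error of the `N`-point trapezoidal rule for a periodic function analytic in a strip. -/
theorem norm_integral_sub_trapezoidal_le {d d' p M : ℝ} {g : ℂ → ℂ} (hp : 0 < p)
    (hg : DifferentiableOn ℂ g (strip d)) (hper : ∀ w ∈ strip d, g (w + p) = g w)
    (hd'0 : 0 < d') (hd' : d' < d) (hM : ∀ w : ℂ, |w.im| = d' → ‖g w‖ ≤ M)
    {N : ℕ} (hN : 1 ≤ N) :
    ‖(∫ u in (0 : ℝ)..p, g u)
        - ((p / N : ℝ) : ℂ) * ∑ k ∈ Finset.range N, g ((k * (p / N) : ℝ) : ℂ)‖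
      ≤ 2 * p * M * (Real.exp (-(2 * Real.pi * d' * N / p))
        / (1 - Real.exp (-(2 * Real.pi * d' * N / p)))) := by
  have hd : 0 < d := hd'0.trans hd'
  have hN0 : (0 : ℝ) < N := by exact_mod_cast hN
  set h : ℝ := p / N with hh
  have hh0 : 0 < h := div_pos hp hN0
  have hNh : N * h = p := by rw [hh]; field_simp
  -- Summing the translates reduces to the one-point rule with period `h = p / N`: a shift by `h`
  -- permutes them cyclically, and `h * G 0` is the trapezoidal sum. The bound becomes `N * M`, with
  -- `h * N = p`.
  set G : ℂ → ℂ := fun w => ∑ k ∈ Finset.range N, g (w + (k * h : ℝ)) with hG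
  have hmaps : ∀ k : ℕ, MapsTo (fun w : ℂ => w + (k * h : ℝ)) (strip d) (strip d) :=
    fun k w hw => add_ofReal_mem_strip hw _
  have hGd : DifferentiableOn ℂ G (strip d) :=
    DifferentiableOn.fun_sum fun k _ => hg.comp (by fun_prop) (hmaps k)
  have hGper : ∀ w ∈ strip d, G (w + h) = G w := fun w hw => by
    have e : ∀ k : ℕ, w + (h : ℂ) + ((k * h : ℝ) : ℂ) = w + (((k + 1 : ℕ) * h : ℝ) : ℂ) :=
      fun k => by push_cast; ring
    have e1 := Finset.sum_range_succ (fun k : ℕ => g (w + (k * h : ℝ))) N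
    have e2 := Finset.sum_range_succ' (fun k : ℕ => g (w + (k * h : ℝ))) N
    simp only [hNh, hper w hw] at e1
    simp only [Nat.cast_zero, zero_mul, Complex.ofReal_zero, add_zero] at e2
    simp only [hG, e]
    exact add_right_cancel (e2.symm.trans e1)
  have hGM : ∀ w : ℂ, |w.im| = d' → ‖G w‖ ≤ N * M := fun w hw => by
    refine (norm_sum_le_of_le _ fun k _ => hM _ (by simpa using hw)).trans_eq (by simp)
  have hgr : Continuous fun u : ℝ => g u :=
    hg.continuousOn.comp_continuous Complex.continuous_ofReal (ofReal_mem_strip hd)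
  have hint : ∫ u in (0 : ℝ)..h, G u = ∫ u in (0 : ℝ)..p, g u := by
    have e1 : ∀ k : ℕ, ∫ u in (0 : ℝ)..h, g (u + (k * h : ℝ))
        = ∫ u in (k * h : ℝ)..((k + 1 : ℕ) * h : ℝ), g u := fun k => by
      have := intervalIntegral.integral_comp_add_right (a := 0) (b := h)
        (fun u : ℝ => g u) (k * h : ℝ)
      simp only [Complex.ofReal_add] at this
      rw [this]
      congr 1
      · ring
      · push_cast; ring
    have e2 := intervalIntegral.sum_integral_adjacent_intervals (f := fun u : ℝ => g u)
      (a := fun k : ℕ => (k * h : ℝ)) (n := N) (μ := MeasureTheory.volume)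
      (fun k _ => hgr.intervalIntegrable _ _)
    simp only [hNh, Nat.cast_zero, zero_mul] at e2
    simp only [hG]
    rw [intervalIntegral.integral_finsetSum, ← e2]
    · exact Finset.sum_congr rfl fun k _ => e1 k
    · intro k _
      refine Continuous.intervalIntegrable ?_ _ _
      have := hgr.comp (continuous_add_const (k * h : ℝ))
      simpa [Function.comp_def] using this
  have key := norm_integral_sub_le_of_periodic_strip hh0 hGd hGper hd'0 hd' hGM
  have hG0 : G 0 = ∑ k ∈ Finset.range N, g ((k * h : ℝ) : ℂ) := by simp [hG]
  rw [hint, hG0] at key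
  have e1 : 2 * Real.pi * d' / h = 2 * Real.pi * d' * N / p := by
    rw [hh]; field_simp
  have e2 : 2 * h * (N * M) = 2 * p * M := by rw [← hNh]; ring
  rwa [e1, e2] at key

/-! ### The loop integrand on the strip, and the error bound. -/

theorem convex_strip (d : ℝ) : Convex ℝ (strip d) := by
  have : strip d = Complex.imLm ⁻¹' Ioo (-d) d := by
    ext w; simp [strip, abs_lt]
  rw [this]
  exact (convex_Ioo _ _).linear_preimage _

/-- Identity theorem: the two sides agree at real points, which accumulate at `0`. -/
theorem periodic_strip_of_periodic_real {d p : ℝ} (hd : 0 < d) {φ : ℂ → ℂ}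
    (hφ : AnalyticOnNhd ℂ φ (strip d)) (hper : ∀ u : ℝ, φ ((u + p : ℝ) : ℂ) = φ (u : ℂ)) :
    ∀ w ∈ strip d, φ (w + p) = φ w := by
  have hshift : AnalyticOnNhd ℂ (fun w => φ (w + p)) (strip d) := fun w hw =>
    (hφ _ (add_ofReal_mem_strip hw p)).comp (f := fun w : ℂ => w + p) (by fun_prop)
  refine hshift.eqOn_of_preconnected_of_frequently_eq hφ (convex_strip d).isPreconnected
    (z₀ := 0) (by simpa using ofReal_mem_strip hd 0) ?_
  have ht : Tendsto (fun u : ℝ => (u : ℂ)) (𝓝[≠] 0) (𝓝[≠] 0) :=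
    tendsto_nhdsWithin_iff.2 ⟨(Complex.continuous_ofReal.tendsto' 0 0 (by simp)).mono_left
      nhdsWithin_le_nhds, by filter_upwards [self_mem_nhdsWithin] with u hu; simpa using hu⟩
  refine ht.frequently (Eventually.frequently (Eventually.of_forall fun u => ?_))
  simpa using hper u

theorem loopIntegrand_periodic_strip {d p : ℝ} {n : ℕ} {f φ : ℂ → ℂ}
    (hper : ∀ w ∈ strip d, φ (w + p) = φ w) :
    ∀ w ∈ strip d, loopIntegrand n f φ (w + p) = loopIntegrand n f φ w := fun w hw => by
  have hderiv : deriv φ (w + p) = deriv φ w := by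
    rw [← deriv_comp_add_const]
    refine Filter.EventuallyEq.deriv_eq ?_
    filter_upwards [(isOpen_strip d).mem_nhds hw] with z hz using hper z hz
  simp only [loopIntegrand, hper w hw, hderiv]

theorem differentiableOn_loopIntegrand {d : ℝ} {n : ℕ} {f φ : ℂ → ℂ}
    (hφ : AnalyticOnNhd ℂ φ (strip d)) (hφseg : φ '' strip d ⊆ unitSegmentᶜ)
    (hf : AnalyticOnNhd ℂ f (φ '' strip d)) :
    DifferentiableOn ℂ (loopIntegrand n f φ) (strip d) := by
  intro w hw
  have hseg : φ w ∉ unitSegment := hφseg ⟨w, hw, rfl⟩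
  have h0 : φ w ≠ 0 := fun h => hseg (h ▸ by simpa using ofReal_mem_unitSegment (x := 0) (by simp))
  have h1 : φ w - 1 ≠ 0 := fun h =>
    hseg (sub_eq_zero.1 h ▸ by simpa using ofReal_mem_unitSegment (x := 1) (by simp))
  have hφw := (hφ w hw).differentiableAt
  have hfw : DifferentiableAt ℂ (fun w => f (φ w)) w :=
    DifferentiableAt.comp (g := f) w (hf _ ⟨w, hw, rfl⟩).differentiableAt hφw
  have hz : DifferentiableAt ℂ (fun w => φ w ^ (-(n : ℤ))) w :=
    DifferentiableAt.comp (g := fun z : ℂ => z ^ (-(n : ℤ))) w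
      (differentiableAt_zpow.2 (Or.inl h0)) hφw
  exact (((hz.mul hfw).mul ((hφw.fun_div (hφw.sub_const 1) h1).clog
    (div_sub_one_mem_slitPlane hseg))).mul (hφ w hw).deriv.differentiableAt).differentiableWithinAt

/-- By periodicity, two compact segments of length `p` already give all the moduli. -/
theorem isGreatest_loopModuli {d d' p : ℝ} {n : ℕ} {f φ : ℂ → ℂ} (hp : 0 < p)
    (hper : ∀ w ∈ strip d, loopIntegrand n f φ (w + p) = loopIntegrand n f φ w)
    (hcont : ContinuousOn (loopIntegrand n f φ) (strip d)) (hd'0 : 0 < d') (hd' : d' < d) :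
    IsGreatest (loopModuli n f φ d') (loopNorm n f φ d') := by
  set K : Set ℂ := Icc (0 : ℝ) p ×ℂ {d', -d'} with hK
  have hKc : IsCompact K := isCompact_Icc.reProdIm (Set.toFinite _).isCompact
  have hline : ∀ w : ℂ, |w.im| = d' → w ∈ strip d := fun w hw => by
    simpa [strip, hw] using hd'
  have hKline : ∀ w ∈ K, |w.im| = d' := fun w hw => by
    rcases hw.2 with h | h <;> rw [h]
    · exact abs_of_pos hd'0
    · rw [abs_neg, abs_of_pos hd'0]
  have heq : loopModuli n f φ d' = (fun w : ℂ => ‖loopIntegrand n f φ w‖) '' K := by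
    refine Subset.antisymm ?_ (image_mono hKline)
    rintro _ ⟨w, hw, rfl⟩
    have hperiodic : Function.Periodic
        (fun x : ℝ => ‖loopIntegrand n f φ (x + w.im * Complex.I)‖) p := fun x => by
      have := hper (x + w.im * Complex.I) (hline _ (by simpa using hw))
      simp only
      rw [← this]
      congr 2
      push_cast; ring
    obtain ⟨y, hy, hyw⟩ := hperiodic.exists_mem_Ico₀ hp w.re
    refine ⟨y + w.im * Complex.I, ⟨?_, ?_⟩, ?_⟩
    · simpa using Ico_subset_Icc_self hy
    · simpa using eq_or_eq_neg_of_abs_eq hw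
    · simp only [Complex.re_add_im] at hyw
      exact hyw.symm
  have hne : K.Nonempty := ⟨(d' : ℂ) * Complex.I, by simp [hp.le], by simp⟩
  rw [loopNorm, heq]
  exact (hKc.image_of_continuousOn
    (hcont.mono fun w hw => hline w (hKline w hw)).norm).isGreatest_sSup (hne.image _)

theorem theorem2
    (n : ℕ) (hn : 1 ≤ n)
    (D : Set ℂ) (hD : IsOpen D) (hsegD : unitSegment ⊆ D)
    (f : ℂ → ℂ) (hfD : AnalyticOnNhd ℂ f D)
    (d p : ℝ) (hd : 0 < d) (hp : 0 < p)
    (φ : ℂ → ℂ) (hφ : AnalyticOnNhd ℂ φ (strip d))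
    (hper : ∀ u : ℝ, φ ((u + p : ℝ) : ℂ) = φ (u : ℂ))
    -- the closed curve `u ↦ φ u`, `0 ≤ u ≤ p`, lies in `D`, encircles `[0,1]` once in the
    -- positive sense and does not wind around any point outside `D`
    (hCD : ∀ u : ℝ, φ (u : ℂ) ∈ D)
    (hwind_one : ∀ a ∈ unitSegment, windingNumber φ p a = 1)
    (hwind_zero : ∀ a ∉ D, windingNumber φ p a = 0)
    (hφseg : φ '' strip d ⊆ unitSegmentᶜ)
    (hf : AnalyticOnNhd ℂ f (φ '' strip d)) :
    Tendsto (fpTruncated n f) (𝓝[>] (0 : ℝ)) (𝓝 (fpIntegral n f)) ∧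
    ∀ d' : ℝ, 0 < d' → d' < d →
      IsGreatest (loopModuli n f φ d') (loopNorm n f φ d') ∧
      ∀ N : ℕ, 1 ≤ N →
        ‖fpIntegral n f - trapezoidalFp n f φ p N‖ ≤
          p / Real.pi * loopNorm n f φ d'
            * (Real.exp (-(2 * Real.pi * d' * N / p))
                / (1 - Real.exp (-(2 * Real.pi * d' * N / p)))) := by
  have h0D : (0 : ℂ) ∈ D := hsegD (by simpa using ofReal_mem_unitSegment (x := 0) (by simp))
  obtain ⟨F, hF, hfF⟩ := exists_analyticOnNhd_taylor_remainder hD h0D hfD n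
  set S : ℂ := ∑ k ∈ Finset.range (n - 1),
    iteratedDeriv k f 0 / ((k.factorial : ℂ) * ((n : ℂ) - 1 - (k : ℂ))) with hS
  have hπ : (2 * (Real.pi : ℂ) * Complex.I) ≠ 0 := Complex.two_pi_I_ne_zero
  have hFc : ContinuousOn (fun x : ℝ => F x) (Icc 0 1) :=
    hF.continuousOn.comp Complex.continuous_ofReal.continuousOn
      fun x hx => hsegD (ofReal_mem_unitSegment hx)
  have hlim : Tendsto (fpTruncated n f) (𝓝[>] (0 : ℝ)) (𝓝 ((∫ x in (0 : ℝ)..1, F x) - S)) := by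
    have hIoc : Ioc (0 : ℝ) 1 ∈ 𝓝[>] (0 : ℝ) := Ioc_mem_nhdsGT one_pos
    have hprim : ContinuousWithinAt (fun ε => ∫ x in ε..1, F x) (Icc 0 1) 0 := by
      have := intervalIntegral.continuousOn_primitive_interval_left (a := 0) (b := 1)
        (μ := MeasureTheory.volume) (f := fun x : ℝ => F x)
        (by rw [uIcc_of_le zero_le_one]; exact hFc.integrableOn_Icc)
      rw [uIcc_of_le zero_le_one] at this
      exact this 0 (by simp)
    have hle : 𝓝[>] (0 : ℝ) ≤ 𝓝[Icc 0 1] 0 :=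
      nhdsWithin_le_iff.2 (mem_of_superset hIoc Ioc_subset_Icc_self)
    refine ((hprim.tendsto.mono_left hle).sub_const S).congr' ?_
    filter_upwards [hIoc] with ε hε
    exact (fpTruncated_eq hsegD hn hF hfF hε.1 hε.2).symm
  have hfp : fpIntegral n f = (∫ x in (0 : ℝ)..1, F x) - S := hlim.limUnder_eq
  refine ⟨hfp ▸ hlim, fun d' hd'0 hd' => ?_⟩
  have hφper := periodic_strip_of_periodic_real hd hφ hper
  have hLper := loopIntegrand_periodic_strip (n := n) (f := f) hφper
  have hLdiff := differentiableOn_loopIntegrand (n := n) hφ hφseg hf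
  have hgreatest := isGreatest_loopModuli hp hLper hLdiff.continuousOn hd'0 hd'
  refine ⟨hgreatest, fun N hN => ?_⟩
  have hwind : ∀ a c, windingNumber φ p a = c →
      ∫ u in (0 : ℝ)..p, deriv φ (u : ℂ) / (φ (u : ℂ) - a) = 2 * Real.pi * Complex.I * c := by
    rintro a c rfl
    rw [windingNumber, mul_inv_cancel_left₀ hπ]
  have hloop := integral_loop_eq_integral_remainder (γ := fun u : ℝ => φ u)
    (γ' := fun u : ℝ => deriv φ u) (p := p)
    (fun u => (hφ u (ofReal_mem_strip hd u)).differentiableAt.hasDerivAt.comp_ofReal)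
    (hφ.deriv.continuousOn.comp_continuous Complex.continuous_ofReal (ofReal_mem_strip hd))
    hper hp hD hsegD hCD (fun a ha => by rw [hwind a 0 (hwind_zero a ha), mul_zero])
    (fun a ha => by rw [hwind a 1 (hwind_one a ha), mul_one])
    (fun u => hφseg ⟨u, ofReal_mem_strip hd u, rfl⟩) hfD hF hfF
  have htrap := norm_integral_sub_trapezoidal_le hp hLdiff hLper hd'0 hd'
    (fun w hw => hgreatest.2 ⟨w, hw, rfl⟩) hN
  have hint : ∫ u in (0 : ℝ)..p, loopIntegrand n f φ u
      = 2 * Real.pi * Complex.I * ∫ x in (0 : ℝ)..1, F x := hloop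
  rw [hint] at htrap
  -- The finite sums cancel; the factor `(2πi)⁻¹` then turns the constant `2 * p` of the trapezoidal
  -- bound into `p / π`.
  have hdiff : fpIntegral n f - trapezoidalFp n f φ p N
      = (2 * Real.pi * Complex.I)⁻¹ * (2 * Real.pi * Complex.I * (∫ x in (0 : ℝ)..1, F x)
        - ((p / N : ℝ) : ℂ)
          * ∑ k ∈ Finset.range N, loopIntegrand n f φ ((k * (p / N) : ℝ) : ℂ)) := by
    rw [hfp, trapezoidalFp, mul_sub, inv_mul_cancel_left₀ hπ]
    ring
  have hnorm : ‖(2 * (Real.pi : ℂ) * Complex.I)⁻¹‖ = (2 * Real.pi)⁻¹ := by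
    simp [abs_of_pos Real.pi_pos]
  rw [hdiff, norm_mul, hnorm]
  calc _ ≤ (2 * Real.pi)⁻¹ * _ := mul_le_mul_of_nonneg_left htrap (by positivity)
    _ = _ := by field_simp
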